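/- For $z\in\mathbb Z^2$ let $\gamma_z=(z,\,z+e_1,\,z+e_1+e_2,\,z+e_2,\,z)$ be the elementary cycle at $z$, where $e_1,e_2$ is the canonical basis, and let $\chi_{\gamma_z}$ be the associated flow: $\chi_{\gamma_z}(x,y)=1$ if the cycle traverses the arc $(x,y)$, $-1$ if it traverses $(y,x)$, and $0$ otherwise. Arcs are ordered pairs of nearest neighbours of $\mathbb Z^2$. For each arc $(x,y)$ let $\gamma^{\pm}(x,y)$ be the unique elementary cycle with $\chi_{\gamma^{\pm}(x,y)}(x,y)=\pm1$. Let $(W_{\gamma_z})_{z\in\mathbb Z^2}$ be real random variables on a probability space with expectation $\mathbf E$, set $$c_a(x,y)=\sum_{z\in\mathbb Z^2}W_{\gamma_z}\,\chi_{\gamma_z}(x,y)=W_{\gamma^+(x,y)}-W_{\gamma^-(x,y)},$$ and let $c_s(x,y)$, for $(x,y)$ an arc, be real random variables such that, almost surely, for every arc $(x,y)$, $c_s(x,y)=c_s(y,x)>0$ and $|c_a(x,y)|\le c_s(x,y)$. Set $c(x,y)=c_s(x,y)+c_a(x,y)\ge 0$ for arcs and $c(x,y)=0$ for all other pairs. Suppose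 that $$\sup_{(x,y)}\ \mathbf E\Big[\,c_s(x,y)+\frac{W_{\gamma^+(x,y)}^2+W_{\gamma^-(x,y)}^2}{c_s(x,y)}\,\Big]<\infty ,$$ where the supremum is over all arcs. Then, for almost every realization of $(c_s,W)$, the random walk with conductances $c$ is recurrent. That is, for every $\mu:\mathbb Z^2\to(0,\infty)$ (which is then a stationary measure), the continuous-time Markov process $X$ on $\mathbb Z^2$ with jump rates $r(x,y)=c(x,y)/\mu(x)$ satisfies $\mathbb P_x[T_x^+<\infty]=1$ for every $x\in\mathbb Z^2$, where $T_x^+=\inf\{t>0: X_t=x,\ X_s\ne X_0\text{ for some }0<s<t\}$ is the return time to $x$. -/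

import Mathlib

open MeasureTheory ProbabilityTheory
open scoped ENNReal NNReal

noncomputable section

namespace AsymConductance

/-! ### Continuous-time Markov jump processes on a countable set -/

section Jump

variable {E : Type*}

/-- The holding rate `λ(x) = ∑_y r(x,y)`. -/
def holdingRate (r : E → E → ℝ) (x : E) : ℝ := ∑' y, r x y

open Classical in
/-- The jump distribution `p(x,·) = r(x,·) / λ(x)`, for a site `x` with `0 < λ(x) < ∞`
(otherwise, by convention, the unit mass at `x`). -/
def jumpPMF (r : E → E → ℝ) (x : E) : PMF E :=
  if h : (∑' y, ENNReal.ofReal (r x y)) ≠ 0 ∧ (∑' y, ENNReal.ofReal (r x y)) ≠ ⊤ then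
    PMF.normalize (fun y => ENNReal.ofReal (r x y)) h.1 h.2
  else PMF.pure x

instance expMeasure_one_isProbabilityMeasure : IsProbabilityMeasure (expMeasure 1) :=
  isProbabilityMeasure_expMeasure one_pos

/-- The time of the `n`-th jump, when `Y` is the sequence of visited sites and the stay at the
`i`-th visited site `Y i` lasts `ξ i / λ(Y i)`. -/
def jumpTime (r : E → E → ℝ) (p : (ℕ → E) × (ℕ → ℝ)) (n : ℕ) : ℝ :=
  ∑ i ∈ Finset.range n, p.2 i / holdingRate r (p.1 i)

/-- `IsAt r p t y` says that `X_t = y`, where `X` is the right-continuous trajectory with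
jump times `jumpTime r p` and visited sites `p.1` (killed at the explosion time, if any). -/
def IsAt (r : E → E → ℝ) (p : (ℕ → E) × (ℕ → ℝ)) (t : ℝ) (y : E) : Prop :=
  ∃ n : ℕ, jumpTime r p n ≤ t ∧ t < jumpTime r p (n + 1) ∧ p.1 n = y

/-- The event that the return time
`T⁺_x = inf {t > 0 : X_t = x, X_s ≠ X_0 for some 0 < s < t}` of a trajectory started at `x`
is finite. -/
def Returns (r : E → E → ℝ) (x : E) (p : (ℕ → E) × (ℕ → ℝ)) : Prop :=
  ∃ t : ℝ, 0 < t ∧ IsAt r p t x ∧ ∃ s : ℝ, 0 < s ∧ s < t ∧ ∃ y, y ≠ x ∧ IsAt r p s y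

variable [MeasurableSpace E] [DiscreteMeasurableSpace E] [Countable E]

/-- The one-step kernel of the jump chain, as a function of the trajectory up to time `n`. -/
def jumpKernel (r : E → E → ℝ) (n : ℕ) : Kernel (Finset.Iic n → E) E :=
  (Kernel.ofFunOfCountable fun x => (jumpPMF r x).toMeasure).comap
    (fun h : Finset.Iic n → E => h ⟨n, by simp⟩) (measurable_pi_apply _)

instance jumpKernel_isMarkovKernel (r : E → E → ℝ) (n : ℕ) :
    IsMarkovKernel (jumpKernel r n) :=
  ⟨fun h => by
    change IsProbabilityMeasure ((jumpPMF r (h ⟨n, by simp⟩)).toMeasure)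
    infer_instance⟩

/-- The law of the jump chain started at `x`. -/
def jumpChainLaw (r : E → E → ℝ) (x : E) : Measure (ℕ → E) :=
  Kernel.trajMeasure (X := fun _ => E) (Measure.dirac x) (jumpKernel r)

/-- The law `ℙ_x` of the Markov process with jump rates `r` started at `x`: the jump chain
started at `x`, together with an independent sequence of independent exponential variables of
mean one, which are divided by the holding rates to give the holding times. -/
def processLaw (r : E → E → ℝ) (x : E) : Measure ((ℕ → E) × (ℕ → ℝ)) :=
  (jumpChainLaw r x).prod (Measure.infinitePi fun _ : ℕ => expMeasure 1)

/-- The Markov process with jump rates `r` is recurrent: from every site it returns to this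
site with probability one. -/
def IsRecurrent (r : E → E → ℝ) : Prop :=
  ∀ x : E, ∀ᵐ p ∂(processLaw r x), Returns r x p

end Jump

/-! ### The square lattice and asymmetric conductances -/

/-- Sites of the square lattice. -/
abbrev Site := ℤ × ℤ

/-- The arcs of the square lattice: ordered pairs of nearest neighbours. -/
def IsArc (x y : Site) : Prop := |x.1 - y.1| + |x.2 - y.2| = 1

instance decidableIsArc : DecidableRel IsArc := fun x y => by
  unfold IsArc; infer_instance

/-- The elementary cycle `γ_z = (z, z+e₁, z+e₁+e₂, z+e₂, z)`. -/
def elemCycle (z : Site) : Fin 5 → Site :=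
  ![z, z + (1, 0), z + (1, 1), z + (0, 1), z]

/-- The flow `χ_γ = ∑_i (δ_{(γ_i, γ_{i+1})} - δ_{(γ_{i+1}, γ_i)})` of the elementary cycle
`γ = γ_z`, evaluated at `(x, y)`. -/
def cycleFlow (z x y : Site) : ℝ :=
  ∑ i : Fin 4,
    ((if (x, y) = (elemCycle z i.castSucc, elemCycle z i.succ) then 1 else 0) -
      (if (x, y) = (elemCycle z i.succ, elemCycle z i.castSucc) then 1 else 0))

/-- The antisymmetric conductance `c_a = ∑_z W_z χ_{γ_z}`
(at each pair of sites at most two terms are nonzero). -/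
def antisymPart (W : Site → ℝ) (x y : Site) : ℝ := ∑' z, W z * cycleFlow z x y

/-- The conductance `c = c_s + c_a` of the arcs (zero on pairs which are not arcs). -/
def conductance (cs : Site → Site → ℝ) (W : Site → ℝ) (x y : Site) : ℝ :=
  if IsArc x y then cs x y + antisymPart W x y else 0

end AsymConductance

end

noncomputable section

namespace AsymConductance

/-! ### Jump chains and their continuous-time processes -/

section Chain

variable {E : Type*} [MeasurableSpace E] [DiscreteMeasurableSpace E] [Countable E]

/-! Recurrence follows from a capacity bound that needs no sector condition. Fix `o`, a finite
domain `D`, and let `u` be the probability of hitting `o` before leaving `D`. Then `u` is harmonic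
on `D` away from `o`, so pairing its generator with any cut-off `f` that is `1` at `o` and vanishes
off `D` gives the same number, the unnormalised escape rate, as pairing with `u` itself.

Pairing with `u` gives the symmetric energy of `u`, because the cycle flows are divergence-free
(`tsum_mul_generator_self`). Pairing with `f` gives the gradient of `u` against a flow, which is
determined only up to a curl. Removing the curl of `2 W f` leaves a test flow in which every `W`
multiplies increments of `f` (`tsum_mul_generator_eq_testFlow`). Young's inequality then bounds the
escape rate by the norm of the test flow (`escape_le_testFlow`).

For a logarithmic cut-off, that norm is a sum over boxes of squared slopes times the variables in
the moment hypothesis. Its expectation is of the order of the inverse of a harmonic number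
(`boxSum_const_le`), so by Fatou its lower limit is almost surely zero (`ae_exists_boxSum_le`). -/

instance jumpChainLaw_isProbabilityMeasure (r : E → E → ℝ) (x : E) :
    IsProbabilityMeasure (jumpChainLaw r x) := by
  unfold jumpChainLaw; infer_instance

/-- One step of the jump chain, integrated against a function of the past and the next site. -/
lemma lintegral_jumpChainLaw_succ (r : E → E → ℝ) (x : E) (n : ℕ)
    (F : (Finset.Iic n → E) → ℝ≥0∞) (hF : Measurable F) (g : E → ℝ≥0∞) :
    ∫⁻ Y, F (Preorder.frestrictLe n Y) * g (Y (n + 1)) ∂(jumpChainLaw r x) =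
      ∫⁻ Y, F (Preorder.frestrictLe n Y) * ∑' y, g y * jumpPMF r (Y n) y
        ∂(jumpChainLaw r x) := by
  have hg : Measurable g := Measurable.of_discrete
  have hG : Measurable fun q : (Finset.Iic n → E) × E => F q.1 * g q.2 := by fun_prop
  -- The joint law of the path up to time `n` and the next site is the composition-product of the
  -- path's law with the one-step kernel.
  have key := Kernel.map_frestrictLe_trajMeasure_compProd_eq_map_trajMeasure
    (X := fun _ => E) (μ₀ := Measure.dirac x) (κ := jumpKernel r) (a := n)
  have h1 := congrArg (fun ν => ∫⁻ q, F q.1 * g q.2 ∂ν) key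
  rw [Measure.lintegral_compProd hG, lintegral_map hG (by fun_prop),
    lintegral_map (Measurable.lintegral_kernel_prod_right' hG) (by fun_prop)] at h1
  unfold jumpChainLaw
  rw [← h1]
  refine lintegral_congr fun Y => ?_
  dsimp only
  rw [lintegral_const_mul _ hg]
  congr 1
  change ∫⁻ y, g y ∂((jumpPMF r (Y n)).toMeasure) = _
  rw [lintegral_countable']
  refine tsum_congr fun y => ?_
  rw [PMF.toMeasure_apply_singleton _ _ (measurableSet_singleton y)]

lemma jumpChainLaw_zero (r : E → E → ℝ) (x : E) :
    ∀ᵐ Y ∂(jumpChainLaw r x), Y 0 = x := by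
  have : (jumpChainLaw r x).map (fun Y => Y 0) = Measure.dirac x := by
    have h0 : (jumpChainLaw r x).map (Preorder.frestrictLe 0) =
        (Measure.dirac x).map (MeasurableEquiv.piUnique fun _ : Finset.Iic 0 => E).symm := by
      unfold jumpChainLaw Kernel.trajMeasure
      rw [Measure.map_comp _ _ (by fun_prop), Kernel.traj_map_frestrictLe,
        Kernel.partialTraj_self, Measure.id_comp]
    have h1 := congrArg (Measure.map fun h : Finset.Iic 0 → E => h ⟨0, by simp⟩) h0
    rw [Measure.map_map (by fun_prop) (by fun_prop), Measure.map_map (by fun_prop) (by fun_prop)]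
      at h1
    refine Eq.trans ?_ (h1.trans ?_)
    · rfl
    · exact Measure.map_id
  have h : ∀ᵐ y ∂((jumpChainLaw r x).map (fun Y => Y 0)), y = x := by
    rw [this, ae_dirac_eq]; simp
  exact ae_of_ae_map (measurable_pi_apply 0).aemeasurable h

lemma lintegral_jumpChainLaw_one (r : E → E → ℝ) (x : E) (g : E → ℝ≥0∞) :
    ∫⁻ Y, g (Y 1) ∂(jumpChainLaw r x) = ∑' y, g y * jumpPMF r x y := by
  have h := lintegral_jumpChainLaw_succ r x 0 (fun _ => 1) measurable_const g
  simp only [one_mul, zero_add] at h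
  rw [h, lintegral_congr_ae (g := fun _ => ∑' y, g y * jumpPMF r x y)]
  · simp
  · filter_upwards [jumpChainLaw_zero r x] with Y hY
    rw [hY]

open Classical in
/-- The probability that the jump chain started at `x` avoids `x` up to time `N` is bounded by means
of any supersolution of the corresponding backward equation. -/
lemma jumpChainLaw_avoid_le (r : E → E → ℝ) (x : E) (w : ℕ → E → ℝ≥0∞)
    (h0 : ∀ y, y ≠ x → 1 ≤ w 0 y)
    (hw : ∀ n y, y ≠ x → ∑' z, w n z * jumpPMF r y z ≤ w (n + 1) y) (N : ℕ) :
    jumpChainLaw r x {Y | ∀ n, Y (n + 1) ≠ x} ≤ ∑' y, w N y * jumpPMF r x y := by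
  -- Conditioning on the last step trades one unit of `k` for one unit of `N`. The indicator keeps
  -- that step's starting site away from `x`, where `hw` applies.
  have key : ∀ k N : ℕ,
      ∫⁻ Y, (if ∀ n < k, Y (n + 1) ≠ x then 1 else 0) * w N (Y (k + 1)) ∂(jumpChainLaw r x)
        ≤ ∑' y, w (N + k) y * jumpPMF r x y := by
    intro k
    induction k with
    | zero => intro N; simp [lintegral_jumpChainLaw_one]
    | succ k ih =>
      intro N
      have hmeas : Measurable fun h : Finset.Iic (k + 1) → E =>
          if ∀ n : Fin (k + 1), h ⟨n + 1, by simp; omega⟩ ≠ x then (1 : ℝ≥0∞) else 0 := by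
        refine Measurable.ite ?_ measurable_const measurable_const
        refine measurableSet_setOfPred.2 (Measurable.forall fun i => ?_)
        exact (Measurable.of_discrete (f := fun y : E => y ≠ x)).comp (measurable_pi_apply _)
      have h := lintegral_jumpChainLaw_succ r x (k + 1) _ hmeas (w N)
      have e : ∀ Y : ℕ → E, (∀ n : Fin (k + 1),
          (Preorder.frestrictLe (k + 1) Y : Finset.Iic (k + 1) → E) ⟨n + 1, by simp; omega⟩ ≠ x) ↔
            ∀ n < k + 1, Y (n + 1) ≠ x :=
        fun Y => ⟨fun H n hn => H ⟨n, hn⟩, fun H n => H n n.2⟩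
      simp only [e] at h
      rw [h]
      refine le_trans (lintegral_mono fun Y => ?_) ((ih (N + 1)).trans_eq ?_)
      · dsimp only
        by_cases H : ∀ n < k + 1, Y (n + 1) ≠ x
        · rw [if_pos H, if_pos fun n hn => H n (by omega), one_mul, one_mul]
          exact hw N _ (H k (by omega))
        · rw [if_neg H]; simp
      · rw [show N + 1 + k = N + (k + 1) by ring]
  have hset : MeasurableSet {Y : ℕ → E | ∀ n, Y (n + 1) ≠ x} := by
    refine measurableSet_setOfPred.2 (Measurable.forall fun i => ?_)
    exact (Measurable.of_discrete (f := fun y : E => y ≠ x)).comp (measurable_pi_apply _)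
  calc jumpChainLaw r x {Y | ∀ n, Y (n + 1) ≠ x}
      = ∫⁻ Y, Set.indicator {Y | ∀ n, Y (n + 1) ≠ x} 1 Y ∂(jumpChainLaw r x) := by
        rw [lintegral_indicator_one hset]
    _ ≤ ∫⁻ Y, (if ∀ n < N, Y (n + 1) ≠ x then 1 else 0) * w 0 (Y (N + 1))
          ∂(jumpChainLaw r x) := by
        refine lintegral_mono fun Y => ?_
        by_cases H : ∀ n, Y (n + 1) ≠ x
        · rw [Set.indicator_of_mem (by exact H), if_pos fun n _ => H n, one_mul]
          exact h0 _ (H N)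
        · rw [Set.indicator_of_notMem (by exact H)]; simp
    _ ≤ ∑' y, w (0 + N) y * jumpPMF r x y := key N 0
    _ = _ := by rw [zero_add]

lemma expMeasure_one_pos : ∀ᵐ t ∂(expMeasure 1), 0 < t := by
  have h : expMeasure 1 (Set.Iic 0) = 0 := by
    rw [← ofReal_cdf, cdf_expMeasure_eq one_pos]; simp
  rw [ae_iff]; simpa [Set.Iic_def] using h

/-- Almost sure return of the jump chain implies almost sure return of the process, when there are
no jumps from a site to itself and all holding rates are positive. -/
lemma ae_returns_of_jumpChain (r : E → E → ℝ) (x : E) (hpos : ∀ y, 0 < holdingRate r y)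
    (hself : jumpPMF r x x = 0)
    (h : jumpChainLaw r x {Y | ∀ n, Y (n + 1) ≠ x} = 0) :
    ∀ᵐ p ∂(processLaw r x), Returns r x p := by
  have hY : ∀ᵐ Y ∂(jumpChainLaw r x), Y 0 = x ∧ Y 1 ≠ x ∧ ∃ n, Y (n + 1) = x := by
    have h1 : ∀ᵐ Y ∂(jumpChainLaw r x), Y 1 ≠ x := by
      classical
      have := lintegral_jumpChainLaw_one r x (fun y => if y = x then 1 else 0)
      have h2 : ∑' y, (if y = x then 1 else 0) * jumpPMF r x y = 0 := by
        rw [ENNReal.tsum_eq_zero]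
        intro y
        by_cases hy : y = x
        · subst hy; simp [hself]
        · simp [hy]
      have hm : Measurable fun y : E => if y = x then (1 : ℝ≥0∞) else 0 := Measurable.of_discrete
      have hm' : Measurable fun Y : ℕ → E => if Y 1 = x then (1 : ℝ≥0∞) else 0 :=
        hm.comp (measurable_pi_apply 1)
      rw [h2, lintegral_eq_zero_iff hm'] at this
      filter_upwards [this] with Y hY hx
      simp [hx] at hY
    have h2 : ∀ᵐ Y ∂(jumpChainLaw r x), ∃ n, Y (n + 1) = x := by
      rw [ae_iff]; simpa using h
    filter_upwards [jumpChainLaw_zero r x, h1, h2] with Y a b c using ⟨a, b, c⟩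
  have hξ : ∀ᵐ ξ ∂(Measure.infinitePi fun _ : ℕ => expMeasure 1), ∀ n, 0 < ξ n := by
    rw [ae_all_iff]
    intro n
    exact (measurePreserving_eval_infinitePi (fun _ : ℕ => expMeasure 1) n).quasiMeasurePreserving.ae
      expMeasure_one_pos
  have hp1 : ∀ᵐ p ∂(processLaw r x), p.1 0 = x ∧ p.1 1 ≠ x ∧ ∃ n, p.1 (n + 1) = x :=
    Measure.quasiMeasurePreserving_fst.ae hY
  have hp2 : ∀ᵐ p ∂(processLaw r x), ∀ n, 0 < p.2 n :=
    Measure.quasiMeasurePreserving_snd.ae hξ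
  filter_upwards [hp1, hp2] with p ⟨_, ha, n, hn⟩ hb
  have hmono : StrictMono (jumpTime r p) := by
    refine strictMono_nat_of_lt_succ fun k => ?_
    unfold jumpTime
    rw [Finset.sum_range_succ]
    have := div_pos (hb k) (hpos (p.1 k))
    linarith
  have hz : jumpTime r p 0 = 0 := by simp [jumpTime]
  have hn0 : n ≠ 0 := fun h => ha (by rw [h] at hn; exact hn)
  have h1 : 0 < jumpTime r p 1 := hz ▸ hmono one_pos
  have h2 : jumpTime r p 1 < jumpTime r p (n + 1) := hmono (by omega)
  -- The return is witnessed at the `(n + 1)`-st jump and the departure at the first. Only finitely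
  -- many jumps are involved, so explosion plays no role.
  exact ⟨jumpTime r p (n + 1), h1.trans h2, ⟨n + 1, le_rfl, hmono (by omega), hn⟩,
    jumpTime r p 1, h1, h2, p.1 1, ha, 1, le_rfl, hmono (by omega), rfl⟩

end Chain

/-! ### Summation by parts and the capacity bound -/

section Dirichlet

open Function

lemma HasFiniteSupport.shift {f : Site → ℝ} (hf : HasFiniteSupport f) (i j : ℤ) :
    HasFiniteSupport fun z : Site => f (z.1 + i, z.2 + j) :=
  Set.Finite.preimage (f := fun z : Site => (z.1 + i, z.2 + j))
    (fun a _ b _ h => by simpa [Prod.ext_iff] using h) hf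

lemma HasFiniteSupport.of_eq_zero {f g : Site → ℝ} (hf : HasFiniteSupport f)
    (h : ∀ z, f z = 0 → g z = 0) : HasFiniteSupport g :=
  Set.Finite.subset hf fun z hz hz' => hz (h z hz')

/-- A function which vanishes where `f` vanishes in the neighbourhood has finite support. -/
lemma HasFiniteSupport.of_local {f g : Site → ℝ} (hf : HasFiniteSupport f)
    (h : ∀ i j, (∀ k l : ℤ, |k| ≤ 1 → |l| ≤ 1 → f (i + k, j + l) = 0) → g (i, j) = 0) :
    HasFiniteSupport g := by
  have hfin : (⋃ k ∈ Set.Icc (-1 : ℤ) 1, ⋃ l ∈ Set.Icc (-1 : ℤ) 1,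
      support fun z : Site => f (z.1 + k, z.2 + l)).Finite :=
    (Set.finite_Icc _ _).biUnion fun k _ => (Set.finite_Icc _ _).biUnion fun l _ =>
      HasFiniteSupport.shift hf k l
  refine Set.Finite.subset hfin fun z hz => ?_
  by_contra hc
  simp only [Set.mem_iUnion, not_exists, mem_support, not_not] at hc
  exact hz (h z.1 z.2 fun k l hk hl => hc k (abs_le.1 hk) l (abs_le.1 hl))

lemma tsum_shift (H : Site → ℝ) (i j : ℤ) : ∑' z : Site, H (z.1 + i, z.2 + j) = ∑' z, H z := by
  exact (Equiv.addRight ((i, j) : Site)).tsum_eq H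

/-- Translation invariance makes the divergence of a finitely supported field sum to zero. Each
summation by parts below amounts to exhibiting suitable `H` and `K`. -/
lemma tsum_eq_of_divergence {F G H K : Site → ℝ} (hG : HasFiniteSupport G)
    (hH : HasFiniteSupport H) (hK : HasFiniteSupport K)
    (h : ∀ i j, F (i, j) = G (i, j) + (H (i, j) - H (i - 1, j)) + (K (i, j) - K (i, j - 1))) :
    ∑' z, F z = ∑' z, G z := by
  have e : F = fun z => G z + (H z - H (z.1 + -1, z.2 + 0)) + (K z - K (z.1 + 0, z.2 + -1)) := by
    ext ⟨i, j⟩; rw [h]; simp [sub_eq_add_neg]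
  have sG : Summable G := summable_of_hasFiniteSupport hG
  have sH : Summable H := summable_of_hasFiniteSupport hH
  have sK : Summable K := summable_of_hasFiniteSupport hK
  have sH' : Summable fun z : Site => H (z.1 + -1, z.2 + 0) :=
    summable_of_hasFiniteSupport (HasFiniteSupport.shift hH (-1) 0)
  have sK' : Summable fun z : Site => K (z.1 + 0, z.2 + -1) :=
    summable_of_hasFiniteSupport (HasFiniteSupport.shift hK 0 (-1))
  rw [e, (sG.add (sH.sub sH')).tsum_add (sK.sub sK'), sG.tsum_add (sH.sub sH'),
    sH.tsum_sub sH', sK.tsum_sub sK', tsum_shift, tsum_shift]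
  ring

variable (a b W : Site → ℝ)

/-- Conductance of the arc `(z, z + e₁)`. -/
def condE (z : Site) : ℝ := a z + (W z - W (z.1, z.2 - 1))
/-- Conductance of the arc `(z + e₁, z)`. -/
def condE' (z : Site) : ℝ := a z - (W z - W (z.1, z.2 - 1))
/-- Conductance of the arc `(z, z + e₂)`. -/
def condN (z : Site) : ℝ := b z + (W (z.1 - 1, z.2) - W z)
/-- Conductance of the arc `(z + e₂, z)`. -/
def condN' (z : Site) : ℝ := b z - (W (z.1 - 1, z.2) - W z)

/-- The sum of `g` over the neighbours of `z`, weighted by the conductances. -/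
def outSum (g : Site → ℝ) (z : Site) : ℝ :=
  condE a W z * g (z.1 + 1, z.2) + condE' a W (z.1 - 1, z.2) * g (z.1 - 1, z.2) +
    condN b W z * g (z.1, z.2 + 1) + condN' b W (z.1, z.2 - 1) * g (z.1, z.2 - 1)

/-- The total conductance at `z`. -/
def outTot (z : Site) : ℝ := a z + a (z.1 - 1, z.2) + b z + b (z.1, z.2 - 1)

/-- The `W` terms of the four outgoing arcs cancel, since cycle flows have no divergence. This is
where stationarity enters. -/
lemma outSum_one_sub (g : Site → ℝ) (z : Site) :
    outSum a b W (fun y => 1 - g y) z = outTot a b z - outSum a b W g z := by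
  simp only [outSum, outTot, condE, condE', condN, condN']; ring

/-- Summation by parts for the generator. -/
lemma tsum_mul_generator {f : Site → ℝ} (hf : HasFiniteSupport f) (u : Site → ℝ) :
    ∑' z, f z * (outTot a b z * u z - outSum a b W u z) =
      ∑' z : Site, (
        (u z - u (z.1 + 1, z.2)) * (f z * condE a W z - f (z.1 + 1, z.2) * condE' a W z) +
        (u z - u (z.1, z.2 + 1)) * (f z * condN b W z - f (z.1, z.2 + 1) * condN' b W z)) := by
  have h1 : HasFiniteSupport fun z : Site => f (z.1 + 1, z.2) := by
    simpa using HasFiniteSupport.shift hf 1 0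
  have h2 : HasFiniteSupport fun z : Site => f (z.1, z.2 + 1) := by
    simpa using HasFiniteSupport.shift hf 0 1
  -- The terms of the arcs `(z + e₁, z)` and `(z + e₂, z)` are moved from their tails to `z`, so
  -- that each edge is accounted for at one site.
  refine tsum_eq_of_divergence
    (H := fun z => f (z.1 + 1, z.2) * (condE' a W z * (u z - u (z.1 + 1, z.2))))
    (K := fun z => f (z.1, z.2 + 1) * (condN' b W z * (u z - u (z.1, z.2 + 1)))) ?_ ?_ ?_ ?_
  · refine Set.Finite.subset (Set.Finite.union hf (Set.Finite.union h1 h2)) fun z hz => ?_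
    by_contra hc
    simp only [Set.mem_union, mem_support, not_or, not_not] at hc
    obtain ⟨e0, e1, e2⟩ := hc
    exact hz (by simp [e0, e1, e2])
  · exact HasFiniteSupport.of_eq_zero h1 fun z hz => by simp [hz]
  · exact HasFiniteSupport.of_eq_zero h2 fun z hz => by simp [hz]
  · intro i j
    simp only [outTot, outSum, condE, condE', condN, condN', sub_add_cancel]
    ring

/-- A gradient is orthogonal to a rotated gradient. -/
lemma tsum_grad_mul_curl {v : Site → ℝ} (hv : HasFiniteSupport v) (g : Site → ℝ) :
    ∑' z : Site, ((v z - v (z.1 + 1, z.2)) * (g z - g (z.1, z.2 - 1)) +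
      (v z - v (z.1, z.2 + 1)) * (g (z.1 - 1, z.2) - g z)) = 0 := by
  have h1 : HasFiniteSupport fun z : Site => v (z.1 + 1, z.2) := by
    simpa using HasFiniteSupport.shift hv 1 0
  have h2 : HasFiniteSupport fun z : Site => v (z.1, z.2 + 1) := by
    simpa using HasFiniteSupport.shift hv 0 1
  have h3 := HasFiniteSupport.shift hv 1 1
  have key : ∀ h : Site → ℝ, HasFiniteSupport h →
      HasFiniteSupport fun z : Site => (h z - v (z.1 + 1, z.2 + 1)) * g z := by
    intro h hh
    refine Set.Finite.subset (Set.Finite.union hh h3) fun z hz => ?_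
    by_contra hc
    simp only [Set.mem_union, mem_support, not_or, not_not] at hc
    obtain ⟨e0, e1⟩ := hc
    exact hz (by simp [e0, e1])
  -- After shifting, the coefficient of `g z` is the circulation of the gradient of `v` around the
  -- square at `z`, which is zero.
  rw [tsum_eq_of_divergence (G := fun _ => 0)
    (H := fun z => -((v (z.1 + 1, z.2) - v (z.1 + 1, z.2 + 1)) * g z))
    (K := fun z => (v (z.1, z.2 + 1) - v (z.1 + 1, z.2 + 1)) * g z) ?_ ?_ ?_ ?_]
  · simp
  · simp [HasFiniteSupport]
  · exact HasFiniteSupport.of_eq_zero (key _ h1) fun z hz => by simpa using hz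
  · exact key _ h2
  · intro i j
    simp only [sub_add_cancel]
    ring

/-- The horizontal component of the test flow associated with `f`. -/
def testE (f : Site → ℝ) (z : Site) : ℝ :=
  a z * (f z - f (z.1 + 1, z.2)) + W z * (f (z.1 + 1, z.2) - f z) -
    W (z.1, z.2 - 1) * (f z + f (z.1 + 1, z.2) - 2 * f (z.1, z.2 - 1))

/-- The vertical component of the test flow associated with `f`. -/
def testN (f : Site → ℝ) (z : Site) : ℝ :=
  b z * (f z - f (z.1, z.2 + 1)) +
    W (z.1 - 1, z.2) * (f z + f (z.1, z.2 + 1) - 2 * f (z.1 - 1, z.2)) -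
    W z * (f (z.1, z.2 + 1) - f z)

/-- The flow from summation by parts contains differences of `W` times sums of values of `f`, which
are not small. Subtracting the curl of `2 W f`, orthogonal to the gradient of `u`, moves the
differences onto `f`. -/
lemma tsum_mul_generator_eq_testFlow {f u : Site → ℝ} (hf : HasFiniteSupport f)
    (hu : HasFiniteSupport u) :
    ∑' z, f z * (outTot a b z * u z - outSum a b W u z) =
      ∑' z : Site, ((u z - u (z.1 + 1, z.2)) * testE a W f z +
        (u z - u (z.1, z.2 + 1)) * testN b W f z) := by
  rw [tsum_mul_generator a b W hf u]
  have hc := tsum_grad_mul_curl hu fun z => 2 * (W z * f z)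
  have s1 : HasFiniteSupport fun z : Site => (u z - u (z.1 + 1, z.2)) * testE a W f z +
      (u z - u (z.1, z.2 + 1)) * testN b W f z := by
    refine HasFiniteSupport.of_local hu fun i j h => ?_
    have h0 := h 0 0 (by simp) (by simp)
    have h1 := h 1 0 (by simp) (by simp)
    have h2 := h 0 1 (by simp) (by simp)
    simp only [add_zero] at h0 h1 h2
    simp [h0, h1, h2]
  have s2 : HasFiniteSupport fun z : Site =>
      (u z - u (z.1 + 1, z.2)) * (2 * (W z * f z) - 2 * (W (z.1, z.2 - 1) * f (z.1, z.2 - 1))) +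
      (u z - u (z.1, z.2 + 1)) * (2 * (W (z.1 - 1, z.2) * f (z.1 - 1, z.2)) - 2 * (W z * f z)) := by
    refine HasFiniteSupport.of_local hu fun i j h => ?_
    have h0 := h 0 0 (by simp) (by simp)
    have h1 := h 1 0 (by simp) (by simp)
    have h2 := h 0 1 (by simp) (by simp)
    simp only [add_zero] at h0 h1 h2
    simp [h0, h1, h2]
  rw [← add_zero (∑' z : Site, ((u z - u (z.1 + 1, z.2)) * testE a W f z + _)), ← hc,
    ← (summable_of_hasFiniteSupport s1).tsum_add (summable_of_hasFiniteSupport s2)]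
  refine tsum_congr fun z => ?_
  simp only [testE, testN, condE, condE', condN, condN']
  ring

lemma hasFiniteSupport_energy {u : Site → ℝ} (hu : HasFiniteSupport u) :
    HasFiniteSupport fun z : Site =>
      a z * (u z - u (z.1 + 1, z.2)) ^ 2 + b z * (u z - u (z.1, z.2 + 1)) ^ 2 := by
  refine HasFiniteSupport.of_local hu fun i j h => ?_
  have h0 := h 0 0 (by simp) (by simp)
  have h1 := h 1 0 (by simp) (by simp)
  have h2 := h 0 1 (by simp) (by simp)
  simp only [add_zero] at h0 h1 h2
  simp [h0, h1, h2]

/-- The Dirichlet form of a finitely supported function is its energy. -/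
lemma tsum_mul_generator_self {u : Site → ℝ} (hu : HasFiniteSupport u) :
    ∑' z, u z * (outTot a b z * u z - outSum a b W u z) =
      ∑' z : Site, (a z * (u z - u (z.1 + 1, z.2)) ^ 2 + b z * (u z - u (z.1, z.2 + 1)) ^ 2) := by
  rw [tsum_mul_generator a b W hu u]
  have hu2 : HasFiniteSupport fun z => u z ^ 2 :=
    HasFiniteSupport.of_eq_zero hu fun z hz => by simp [hz]
  -- The antisymmetric part multiplies `u z - u y` by `u z + u y`, so it pairs the gradient of `u ^
  -- 2` with a curl and drops out.
  have hc := tsum_grad_mul_curl hu2 W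
  have s2 : HasFiniteSupport fun z : Site =>
      (u z ^ 2 - u (z.1 + 1, z.2) ^ 2) * (W z - W (z.1, z.2 - 1)) +
      (u z ^ 2 - u (z.1, z.2 + 1) ^ 2) * (W (z.1 - 1, z.2) - W z) := by
    refine HasFiniteSupport.of_local hu fun i j h => ?_
    have h0 := h 0 0 (by simp) (by simp)
    have h1 := h 1 0 (by simp) (by simp)
    have h2 := h 0 1 (by simp) (by simp)
    simp only [add_zero] at h0 h1 h2
    simp [h0, h1, h2]
  rw [← add_zero (∑' z : Site, (a z * _ + _)), ← hc,
    ← (summable_of_hasFiniteSupport (hasFiniteSupport_energy a b hu)).tsum_add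
      (summable_of_hasFiniteSupport s2)]
  refine tsum_congr fun z => ?_
  simp only [condE, condE', condN, condN']
  ring

lemma hasFiniteSupport_testFlow {f : Site → ℝ} (hf : HasFiniteSupport f) :
    HasFiniteSupport fun z : Site => testE a W f z ^ 2 / a z + testN b W f z ^ 2 / b z := by
  refine HasFiniteSupport.of_local hf fun i j h => ?_
  have h0 := h 0 0 (by simp) (by simp)
  have h1 := h 1 0 (by simp) (by simp)
  have h2 := h 0 1 (by simp) (by simp)
  have h3 := h (-1) 0 (by simp) (by simp)
  have h4 := h 0 (-1) (by simp) (by simp)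
  simp only [add_zero, ← sub_eq_add_neg] at h0 h1 h2 h3 h4
  simp [testE, testN, h0, h1, h2, h3, h4]

/-- Upper bound for the capacity of `o` by the norm of the test flow of any cut-off function. -/
lemma escape_le_testFlow {u f : Site → ℝ} (hu : HasFiniteSupport u) (hf : HasFiniteSupport f)
    (ha : ∀ z, 0 < a z) (hb : ∀ z, 0 < b z) (o : Site) (huo : u o = 1) (hfo : f o = 1)
    (hharm : ∀ z, z ≠ o → (u z = 0 ∧ f z = 0) ∨ outSum a b W u z = outTot a b z * u z) :
    outTot a b o - outSum a b W u o ≤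
      ∑' z, (testE a W f z ^ 2 / a z + testN b W f z ^ 2 / b z) := by
  have e1 : ∑' z, u z * (outTot a b z * u z - outSum a b W u z) =
      outTot a b o - outSum a b W u o := by
    rw [tsum_eq_single o fun z hz => ?_]
    · simp [huo]
    · rcases hharm z hz with h | h <;> simp [h]
  have e2 : ∑' z, f z * (outTot a b z * u z - outSum a b W u z) =
      outTot a b o - outSum a b W u o := by
    rw [tsum_eq_single o fun z hz => ?_]
    · simp [huo, hfo]
    · rcases hharm z hz with h | h <;> simp [h]
  rw [tsum_mul_generator_self a b W hu] at e1
  rw [tsum_mul_generator_eq_testFlow a b W hf hu] at e2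
  have sE : Summable fun z : Site => a z * (u z - u (z.1 + 1, z.2)) ^ 2 +
      b z * (u z - u (z.1, z.2 + 1)) ^ 2 :=
    summable_of_hasFiniteSupport (hasFiniteSupport_energy a b hu)
  have sT : Summable fun z => testE a W f z ^ 2 / a z + testN b W f z ^ 2 / b z :=
    summable_of_hasFiniteSupport (hasFiniteSupport_testFlow a b W hf)
  have young : ∀ c x y : ℝ, 0 < c → x * y ≤ 1 / 2 * (c * x ^ 2) + 1 / 2 * (y ^ 2 / c) := by
    intro c x y hc
    have : 1 / 2 * (c * x ^ 2) + 1 / 2 * (y ^ 2 / c) - x * y = (c * x - y) ^ 2 / (2 * c) := by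
      field_simp; ring
    have h2 : 0 ≤ (c * x - y) ^ 2 / (2 * c) := by positivity
    linarith
  -- The energy of `u` is the escape rate itself, so Young's inequality with weights `1/2` lets it
  -- be absorbed on the left.
  have hle : outTot a b o - outSum a b W u o ≤
      1 / 2 * (outTot a b o - outSum a b W u o) + 1 / 2 *
        ∑' z, (testE a W f z ^ 2 / a z + testN b W f z ^ 2 / b z) := by
    conv_lhs => rw [← e2]
    conv_rhs => rw [← e1]
    rw [← tsum_mul_left, ← tsum_mul_left, ← (sE.mul_left _).tsum_add (sT.mul_left _)]
    refine Summable.tsum_le_tsum (fun z => ?_) ?_ ((sE.mul_left _).add (sT.mul_left _))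
    · have h1 := young (a z) (u z - u (z.1 + 1, z.2)) (testE a W f z) (ha z)
      have h2 := young (b z) (u z - u (z.1, z.2 + 1)) (testN b W f z) (hb z)
      linarith
    · refine summable_of_hasFiniteSupport (HasFiniteSupport.of_local hu fun i j h => ?_)
      have h0 := h 0 0 (by simp) (by simp)
      have h1 := h 1 0 (by simp) (by simp)
      have h2 := h 0 1 (by simp) (by simp)
      simp only [add_zero] at h0 h1 h2
      simp [h0, h1, h2]
  linarith

end Dirichlet

/-! ### The Dirichlet problem and the escape probability -/

section Escape

open Function Filter Topology

variable (a b W : Site → ℝ)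

open Classical in
/-- The probability not to have hit `o`, within `n` steps and before leaving `D`. -/
def survive (D : Set Site) (o : Site) : ℕ → Site → ℝ
  | 0, z => if z = o then 0 else 1
  | n + 1, z => if z = o then 0 else
      if z ∈ D then outSum a b W (survive D o n) z / outTot a b z else 1

/-- Positivity of the symmetric part and nonnegativity of the conductances. -/
structure IsAdmissible : Prop where
  a_pos : ∀ z, 0 < a z
  b_pos : ∀ z, 0 < b z
  condE_nonneg : ∀ z, 0 ≤ condE a W z
  condE'_nonneg : ∀ z, 0 ≤ condE' a W z
  condN_nonneg : ∀ z, 0 ≤ condN b W z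
  condN'_nonneg : ∀ z, 0 ≤ condN' b W z

variable {a b W} (hA : IsAdmissible a b W)
include hA

lemma outTot_pos (z : Site) : 0 < outTot a b z := by
  have h1 := hA.a_pos
  have h2 := hA.b_pos
  have := h1 z; have := h1 (z.1 - 1, z.2); have := h2 z; have := h2 (z.1, z.2 - 1)
  unfold outTot; linarith

lemma outSum_mono {g h : Site → ℝ} (hgh : ∀ z, g z ≤ h z) (z : Site) :
    outSum a b W g z ≤ outSum a b W h z := by
  have h1 := hA.condE_nonneg z
  have h2 := hA.condE'_nonneg (z.1 - 1, z.2)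
  have h3 := hA.condN_nonneg z
  have h4 := hA.condN'_nonneg (z.1, z.2 - 1)
  unfold outSum
  gcongr <;> exact hgh _

lemma outSum_nonneg {g : Site → ℝ} (hg : ∀ z, 0 ≤ g z) (z : Site) : 0 ≤ outSum a b W g z := by
  have := outSum_mono hA (g := fun _ => 0) (h := g) hg z
  simpa [outSum] using this

lemma outSum_le_outTot {g : Site → ℝ} (hg : ∀ z, g z ≤ 1) (z : Site) :
    outSum a b W g z ≤ outTot a b z := by
  have h := outSum_mono hA (g := g) (h := fun _ => 1) hg z
  have h1 := outSum_one_sub a b W (fun _ => 0) z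
  have h0 : outSum a b W (fun _ => 0) z = 0 := by simp [outSum]
  simp only [sub_zero, h0] at h1
  exact h.trans_eq h1

lemma survive_mem (D : Set Site) (o : Site) (n : ℕ) (z : Site) :
    0 ≤ survive a b W D o n z ∧ survive a b W D o n z ≤ 1 := by
  induction n generalizing z with
  | zero => unfold survive; split_ifs <;> norm_num
  | succ n ih =>
    unfold survive
    split_ifs
    · norm_num
    · exact ⟨div_nonneg (outSum_nonneg hA (fun y => (ih y).1) z) (outTot_pos hA z).le,
        (div_le_one (outTot_pos hA z)).2 (outSum_le_outTot hA (fun y => (ih y).2) z)⟩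
    · norm_num

lemma survive_succ_le (D : Set Site) (o : Site) (n : ℕ) (z : Site) :
    survive a b W D o (n + 1) z ≤ survive a b W D o n z := by
  induction n generalizing z with
  | zero =>
    have h := (survive_mem hA D o 1 z).2
    by_cases hz : z = o
    · simp [survive, hz]
    · simpa [survive, hz] using h
  | succ n ih =>
    have := outSum_mono hA ih z
    have hp := outTot_pos hA z
    rw [survive, survive]
    split_ifs <;> first | exact le_rfl | (gcongr)

/-- The iterates decrease and are nonnegative, and `outSum` has only four terms, so the recursion
passes to the limit. This solves the Dirichlet problem by iteration. -/
lemma exists_survive_limit (D : Set Site) (o : Site) :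
    ∃ w : Site → ℝ, (∀ z, Tendsto (fun n => survive a b W D o n z) atTop (𝓝 (w z))) ∧
      w o = 0 ∧ (∀ z, z ∉ D → z ≠ o → w z = 1) ∧
      ∀ z, z ∈ D → z ≠ o → outSum a b W w z = outTot a b z * w z := by
  have hex : ∀ z, ∃ l, Tendsto (fun n => survive a b W D o n z) atTop (𝓝 l) := fun z =>
    ⟨_, tendsto_atTop_ciInf (antitone_nat_of_succ_le fun n => survive_succ_le hA D o n z)
      ⟨0, by rintro _ ⟨n, rfl⟩; exact (survive_mem hA D o n z).1⟩⟩
  choose w hw using hex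
  have hw' : ∀ z, Tendsto (fun n => survive a b W D o (n + 1) z) atTop (𝓝 (w z)) :=
    fun z => (hw z).comp (tendsto_add_atTop_nat 1)
  refine ⟨w, hw, ?_, fun z hz hzo => ?_, fun z hz hzo => ?_⟩
  · refine tendsto_nhds_unique (hw' o) ?_
    simp [survive]
  · refine tendsto_nhds_unique (hw' z) ?_
    simp [survive, hz, hzo]
  · have h1 : Tendsto (fun n => outSum a b W (survive a b W D o n) z) atTop
        (𝓝 (outSum a b W w z)) := by
      unfold outSum
      exact ((((hw _).const_mul _).add ((hw _).const_mul _)).add ((hw _).const_mul _)).add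
        ((hw _).const_mul _)
    have h2 := hw' z
    simp only [survive, hz, hzo, if_true, if_false] at h2
    have h3 := tendsto_nhds_unique h2 (h1.div_const _)
    rw [h3, mul_div_cancel₀ _ (outTot_pos hA z).ne']

/-- The jump chain avoids its starting point with a probability controlled by the norm of the test
flow of any cut-off function. -/
lemma jumpChainLaw_avoid_le_testFlow {r : Site → Site → ℝ}
    (hr : ∀ (z : Site) (g : Site → ℝ), (∀ y, 0 ≤ g y) →
      ∑' y, ENNReal.ofReal (g y) * jumpPMF r z y =
        ENNReal.ofReal (outSum a b W g z / outTot a b z))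
    {f : Site → ℝ} (hf : HasFiniteSupport f) (o : Site) (hfo : f o = 1) :
    jumpChainLaw r o {Y | ∀ n, Y (n + 1) ≠ o} ≤ ENNReal.ofReal
      ((∑' z, (testE a W f z ^ 2 / a z + testN b W f z ^ 2 / b z)) / outTot a b o) := by
  set D : Set Site := support f with hD
  obtain ⟨w, hw, hwo, hw1, hwD⟩ := exists_survive_limit hA D o
  have hmem := survive_mem hA D o
  have hbound : ∀ N, jumpChainLaw r o {Y | ∀ n, Y (n + 1) ≠ o} ≤
      ENNReal.ofReal (outSum a b W (survive a b W D o N) o / outTot a b o) := by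
    intro N
    rw [← hr o _ fun y => (hmem N y).1]
    -- The backward equation holds with equality in `D`. Outside, the value `1` dominates any
    -- average of numbers at most `1`.
    refine jumpChainLaw_avoid_le r o (fun n y => ENNReal.ofReal (survive a b W D o n y)) ?_ ?_ N
    · intro y hy; simp [survive, hy]
    · intro n y hy
      rw [hr y _ fun x => (hmem n x).1]
      refine ENNReal.ofReal_le_ofReal ?_
      rw [survive]
      simp only [hy, if_false]
      split_ifs
      · exact le_rfl
      · exact (div_le_one (outTot_pos hA y)).2 (outSum_le_outTot hA (fun x => (hmem n x).2) y)
  have hlim : Tendsto (fun n => outSum a b W (survive a b W D o n) o) atTop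
      (𝓝 (outSum a b W w o)) := by
    unfold outSum
    exact ((((hw _).const_mul _).add ((hw _).const_mul _)).add ((hw _).const_mul _)).add
      ((hw _).const_mul _)
  have hle := ge_of_tendsto' (ENNReal.tendsto_ofReal (hlim.div_const (outTot a b o))) hbound
  refine hle.trans (ENNReal.ofReal_le_ofReal ?_)
  have hoD : o ∈ D := by simp [hD, hfo]
  have hu : HasFiniteSupport fun z => 1 - w z := by
    refine Set.Finite.subset hf fun z hz => ?_
    by_contra hzD
    exact hz (by simp [hw1 z hzD fun h => hzD (h ▸ hoD)])
  -- Here `u = 1 - w`; it is supported in `D`, the support of `f`, so off `D` both functions vanish.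
  have h := escape_le_testFlow a b W hu hf hA.a_pos hA.b_pos o (by simp [hwo]) hfo fun z hz => ?_
  · rw [outSum_one_sub] at h
    have := outTot_pos hA o
    gcongr
    linarith
  · by_cases hzD : z ∈ D
    · right
      rw [outSum_one_sub, hwD z hzD hz]; ring
    · left
      exact ⟨by simp [hw1 z hzD hz], by simpa [hD] using hzD⟩

omit hA in
/-- Sums against the neighbours of a site. -/
lemma tsum_mul_of_neighbours (r : Site → Site → ℝ) (z : Site)
    (h0 : ∀ y : Site, y ≠ (z.1 + 1, z.2) → y ≠ (z.1 - 1, z.2) → y ≠ (z.1, z.2 + 1) →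
      y ≠ (z.1, z.2 - 1) → r z y = 0) (G : Site → ℝ≥0∞) :
    ∑' y, G y * ENNReal.ofReal (r z y) =
      G (z.1 + 1, z.2) * ENNReal.ofReal (r z (z.1 + 1, z.2)) +
      G (z.1 - 1, z.2) * ENNReal.ofReal (r z (z.1 - 1, z.2)) +
      G (z.1, z.2 + 1) * ENNReal.ofReal (r z (z.1, z.2 + 1)) +
      G (z.1, z.2 - 1) * ENNReal.ofReal (r z (z.1, z.2 - 1)) := by
  rw [tsum_eq_sum (s := {((z.1 + 1, z.2) : Site), (z.1 - 1, z.2), (z.1, z.2 + 1), (z.1, z.2 - 1)})]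
  · rw [Finset.sum_insert, Finset.sum_insert, Finset.sum_insert, Finset.sum_singleton]
    · ring
    all_goals simp [Prod.ext_iff]
    all_goals omega
  · intro y hy
    simp only [Finset.mem_insert, Finset.mem_singleton, not_or] at hy
    rw [h0 y hy.1 hy.2.1 hy.2.2.1 hy.2.2.2]; simp

/-- Normalising the rates cancels `m z`, so the jump chain does not depend on the stationary
measure. -/
lemma tsum_mul_jumpPMF {r : Site → Site → ℝ} {m : Site → ℝ} (hm : ∀ x, 0 < m x)
    (hE : ∀ z, r z (z.1 + 1, z.2) = condE a W z / m z)
    (hE' : ∀ z, r z (z.1 - 1, z.2) = condE' a W (z.1 - 1, z.2) / m z)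
    (hN : ∀ z, r z (z.1, z.2 + 1) = condN b W z / m z)
    (hN' : ∀ z, r z (z.1, z.2 - 1) = condN' b W (z.1, z.2 - 1) / m z)
    (h0 : ∀ z y : Site, y ≠ (z.1 + 1, z.2) → y ≠ (z.1 - 1, z.2) → y ≠ (z.1, z.2 + 1) →
      y ≠ (z.1, z.2 - 1) → r z y = 0)
    (z : Site) (g : Site → ℝ) (hg : ∀ y, 0 ≤ g y) :
    ∑' y, ENNReal.ofReal (g y) * jumpPMF r z y =
      ENNReal.ofReal (outSum a b W g z / outTot a b z) := by
  have hmz := hm z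
  have key : ∀ g : Site → ℝ, (∀ y, 0 ≤ g y) →
      ∑' y, ENNReal.ofReal (g y) * ENNReal.ofReal (r z y) =
        ENNReal.ofReal (outSum a b W g z / m z) := by
    intro g hg
    have h1 := hA.condE_nonneg z
    have h2 := hA.condE'_nonneg (z.1 - 1, z.2)
    have h3 := hA.condN_nonneg z
    have h4 := hA.condN'_nonneg (z.1, z.2 - 1)
    have g1 := hg (z.1 + 1, z.2)
    have g2 := hg (z.1 - 1, z.2)
    have g3 := hg (z.1, z.2 + 1)
    have g4 := hg (z.1, z.2 - 1)
    rw [tsum_mul_of_neighbours r z (h0 z), hE, hE', hN, hN', ← ENNReal.ofReal_mul g1,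
      ← ENNReal.ofReal_mul g2, ← ENNReal.ofReal_mul g3, ← ENNReal.ofReal_mul g4,
      ← ENNReal.ofReal_add (by positivity) (by positivity),
      ← ENNReal.ofReal_add (by positivity) (by positivity),
      ← ENNReal.ofReal_add (by positivity) (by positivity)]
    congr 1
    unfold outSum
    ring
  have htot : ∑' y, ENNReal.ofReal (r z y) = ENNReal.ofReal (outTot a b z / m z) := by
    have h := key (fun _ => 1) fun _ => zero_le_one
    have h1 := outSum_one_sub a b W (fun _ => 0) z
    have h00 : outSum a b W (fun _ => 0) z = 0 := by simp [outSum]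
    simp only [sub_zero, h00] at h1
    simpa [h1] using h
  have hp : 0 < outTot a b z / m z := div_pos (outTot_pos hA z) hmz
  have hcond : (∑' y, ENNReal.ofReal (r z y)) ≠ 0 ∧ (∑' y, ENNReal.ofReal (r z y)) ≠ ⊤ := by
    rw [htot]; exact ⟨(ENNReal.ofReal_pos.2 hp).ne', ENNReal.ofReal_ne_top⟩
  rw [jumpPMF, dif_pos hcond]
  simp only [PMF.normalize_apply, ← mul_assoc]
  rw [ENNReal.tsum_mul_right, key g hg, htot, ← ENNReal.ofReal_inv_of_pos hp,
    ← ENNReal.ofReal_mul (div_nonneg (outSum_nonneg hA hg z) hmz.le)]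
  congr 1
  have := outTot_pos hA z
  field_simp

end Escape

/-! ### Elementary cycles and arcs of the square lattice -/

section Lattice

lemma cycleFlow_antisymm (z x y : Site) : cycleFlow z y x = -cycleFlow z x y := by
  simp only [cycleFlow, Fin.sum_univ_four, Prod.mk.injEq, and_comm]
  ring

lemma cycleFlow_right (z : Site) (i j : ℤ) :
    cycleFlow z (i, j) (i + 1, j) =
      (if z = (i, j) then 1 else 0) - (if z = (i, j - 1) then 1 else 0) := by
  obtain ⟨k, l⟩ := z
  simp only [cycleFlow, elemCycle, Fin.sum_univ_four, Prod.mk.injEq]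
  simp
  split_ifs <;> first | omega | norm_num

lemma cycleFlow_up (z : Site) (i j : ℤ) :
    cycleFlow z (i, j) (i, j + 1) =
      (if z = (i - 1, j) then 1 else 0) - (if z = (i, j) then 1 else 0) := by
  obtain ⟨k, l⟩ := z
  simp only [cycleFlow, elemCycle, Fin.sum_univ_four, Prod.mk.injEq]
  simp
  split_ifs <;> first | omega | norm_num

lemma tsum_mul_single_sub (W : Site → ℝ) (p q : Site) :
    ∑' z, W z * ((if z = p then 1 else 0) - (if z = q then 1 else 0)) = W p - W q := by
  have h : ∀ s : Site, HasSum (fun z => W z * if z = s then 1 else 0) (W s) := fun s => by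
    simpa using hasSum_single (f := fun z => W z * if z = s then 1 else 0) s
      (fun z hz => by simp [hz])
  simp only [mul_sub]
  exact ((h p).sub (h q)).tsum_eq

lemma antisymPart_antisymm (W : Site → ℝ) (x y : Site) :
    antisymPart W y x = -antisymPart W x y := by
  unfold antisymPart
  rw [← tsum_neg]
  refine tsum_congr fun z => ?_
  rw [cycleFlow_antisymm]; ring

lemma antisymPart_right (W : Site → ℝ) (z : Site) :
    antisymPart W z (z.1 + 1, z.2) = W z - W (z.1, z.2 - 1) := by
  obtain ⟨i, j⟩ := z
  simp only [antisymPart, cycleFlow_right, tsum_mul_single_sub]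

lemma antisymPart_up (W : Site → ℝ) (z : Site) :
    antisymPart W z (z.1, z.2 + 1) = W (z.1 - 1, z.2) - W z := by
  obtain ⟨i, j⟩ := z
  simp only [antisymPart, cycleFlow_up, tsum_mul_single_sub]

lemma isArc_right (z : Site) : IsArc z (z.1 + 1, z.2) := by simp [IsArc]
lemma isArc_left (z : Site) : IsArc (z.1 + 1, z.2) z := by simp [IsArc]
lemma isArc_up (z : Site) : IsArc z (z.1, z.2 + 1) := by simp [IsArc]
lemma isArc_down (z : Site) : IsArc (z.1, z.2 + 1) z := by simp [IsArc]

lemma not_isArc {z y : Site} (h1 : y ≠ (z.1 + 1, z.2)) (h2 : y ≠ (z.1 - 1, z.2))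
    (h3 : y ≠ (z.1, z.2 + 1)) (h4 : y ≠ (z.1, z.2 - 1)) : ¬ IsArc z y := by
  obtain ⟨i, j⟩ := z
  obtain ⟨k, l⟩ := y
  simp only [IsArc, ne_eq, Prod.mk.injEq] at *
  intro h
  rcases abs_cases (i - k) with ⟨e, _⟩ | ⟨e, _⟩ <;> rcases abs_cases (j - l) with ⟨e', _⟩ | ⟨e', _⟩ <;>
    rw [e, e'] at h <;> omega

end Lattice

/-! ### Recurrence for fixed conductances -/

section Quenched

lemma holdingRate_pos {a b W : Site → ℝ} (hA : IsAdmissible a b W) {r : Site → Site → ℝ}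
    {m : Site → ℝ} (hm : ∀ x, 0 < m x)
    (hE : ∀ z, r z (z.1 + 1, z.2) = condE a W z / m z)
    (hE' : ∀ z, r z (z.1 - 1, z.2) = condE' a W (z.1 - 1, z.2) / m z)
    (hN : ∀ z, r z (z.1, z.2 + 1) = condN b W z / m z)
    (hN' : ∀ z, r z (z.1, z.2 - 1) = condN' b W (z.1, z.2 - 1) / m z)
    (h0 : ∀ z y : Site, y ≠ (z.1 + 1, z.2) → y ≠ (z.1 - 1, z.2) → y ≠ (z.1, z.2 + 1) →
      y ≠ (z.1, z.2 - 1) → r z y = 0) (z : Site) : 0 < holdingRate r z := by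
  have h : holdingRate r z = outTot a b z / m z := by
    rw [holdingRate, tsum_eq_sum
      (s := {((z.1 + 1, z.2) : Site), (z.1 - 1, z.2), (z.1, z.2 + 1), (z.1, z.2 - 1)})]
    · rw [Finset.sum_insert, Finset.sum_insert, Finset.sum_insert, Finset.sum_singleton,
        hE, hE', hN, hN']
      · simp only [outTot, condE, condE', condN, condN']; ring
      all_goals simp [Prod.ext_iff]
      all_goals omega
    · intro y hy
      simp only [Finset.mem_insert, Finset.mem_singleton, not_or] at hy
      exact h0 z y hy.1 hy.2.1 hy.2.2.1 hy.2.2.2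
  rw [h]
  exact div_pos (outTot_pos hA z) (hm z)

variable {cs : Site → Site → ℝ} {W : Site → ℝ}
  (hpos : ∀ x y, IsArc x y → 0 < cs x y) (hsymm : ∀ x y, IsArc x y → cs x y = cs y x)
  (hdom : ∀ x y, IsArc x y → |antisymPart W x y| ≤ cs x y)
include hpos hsymm hdom

/-- For fixed conductances, the process is recurrent as soon as there are cut-off functions
whose test flows have arbitrarily small norms. -/
theorem isRecurrent_of_testFlow
    (hflow : ∀ o : Site, ∀ ε : ℝ, 0 < ε → ∃ f : Site → ℝ, Function.HasFiniteSupport f ∧ f o = 1 ∧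
      ∑' z : Site, (testE (fun z => cs z (z.1 + 1, z.2)) W f z ^ 2 / cs z (z.1 + 1, z.2) +
        testN (fun z => cs z (z.1, z.2 + 1)) W f z ^ 2 / cs z (z.1, z.2 + 1)) ≤ ε)
    {m : Site → ℝ} (hm : ∀ x, 0 < m x) :
    IsRecurrent fun x y => conductance cs W x y / m x := by
  set a : Site → ℝ := fun z => cs z (z.1 + 1, z.2) with ha
  set b : Site → ℝ := fun z => cs z (z.1, z.2 + 1) with hb
  have hE : ∀ z : Site, conductance cs W z (z.1 + 1, z.2) = condE a W z := fun z => by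
    rw [conductance, if_pos (isArc_right z), antisymPart_right]; rfl
  have hE' : ∀ z : Site, conductance cs W (z.1 + 1, z.2) z = condE' a W z := fun z => by
    rw [conductance, if_pos (isArc_left z), antisymPart_antisymm, antisymPart_right,
      ← hsymm _ _ (isArc_right z)]; simp only [condE', ha]; ring
  have hN : ∀ z : Site, conductance cs W z (z.1, z.2 + 1) = condN b W z := fun z => by
    rw [conductance, if_pos (isArc_up z), antisymPart_up]; rfl
  have hN' : ∀ z : Site, conductance cs W (z.1, z.2 + 1) z = condN' b W z := fun z => by
    rw [conductance, if_pos (isArc_down z), antisymPart_antisymm, antisymPart_up,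
      ← hsymm _ _ (isArc_up z)]; simp only [condN', hb]; ring
  have hnn : ∀ x y, 0 ≤ conductance cs W x y := fun x y => by
    unfold conductance
    split_ifs with h
    · linarith [(abs_le.1 (hdom x y h)).1]
    · exact le_rfl
  have hA : IsAdmissible a b W :=
    ⟨fun z => hpos _ _ (isArc_right z), fun z => hpos _ _ (isArc_up z),
      fun z => hE z ▸ hnn _ _, fun z => hE' z ▸ hnn _ _, fun z => hN z ▸ hnn _ _,
      fun z => hN' z ▸ hnn _ _⟩
  intro o
  set r : Site → Site → ℝ := fun x y => conductance cs W x y / m x with hr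
  have hr0 : ∀ z y : Site, y ≠ (z.1 + 1, z.2) → y ≠ (z.1 - 1, z.2) → y ≠ (z.1, z.2 + 1) →
      y ≠ (z.1, z.2 - 1) → r z y = 0 := fun z y h1 h2 h3 h4 => by
    simp [hr, conductance, not_isArc h1 h2 h3 h4]
  have hjump := tsum_mul_jumpPMF hA (r := r) hm (fun z => by rw [hr, ← hE])
    (fun z => by rw [hr, ← hE']; simp) (fun z => by rw [hr, ← hN])
    (fun z => by rw [hr, ← hN']; simp) hr0
  refine ae_returns_of_jumpChain r o (fun y => ?_) ?_ ?_
  · exact holdingRate_pos hA hm (fun z => by rw [hr, ← hE])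
      (fun z => by rw [hr, ← hE']; simp) (fun z => by rw [hr, ← hN])
      (fun z => by rw [hr, ← hN']; simp) hr0 y
  · classical
    -- Testing against the indicator of `o` shows that the chain makes no jump from `o` to itself.
    have h := hjump o (fun y => if y = o then 1 else 0) fun y => by split_ifs <;> norm_num
    rw [tsum_eq_single o fun y hy => by simp [hy]] at h
    simpa [outSum, Prod.ext_iff] using h
  · refine le_antisymm (ENNReal.le_of_forall_pos_le_add fun ε hε _ => ?_) bot_le
    have hT := outTot_pos hA o
    obtain ⟨f, hf, hfo, hle⟩ := hflow o (ε * outTot a b o) (by positivity)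
    refine (jumpChainLaw_avoid_le_testFlow hA hjump hf o hfo).trans ?_
    rw [zero_add, ← ENNReal.ofReal_coe_nnreal]
    refine ENNReal.ofReal_le_ofReal ?_
    rw [div_le_iff₀ hT]
    exact hle

end Quenched

/-! ### Logarithmic cut-offs and moment bounds -/

section Cutoff

open Function Filter Topology

/-- The harmonic numbers, as real numbers. -/
def harm (n : ℕ) : ℝ := ∑ i ∈ Finset.range n, 1 / ((i : ℝ) + 1)

lemma harm_succ (n : ℕ) : harm (n + 1) = harm n + 1 / ((n : ℝ) + 1) :=
  Finset.sum_range_succ _ _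

lemma harm_mono : Monotone harm := monotone_nat_of_le_succ fun n => by
  rw [harm_succ]; have : 0 < 1 / ((n : ℝ) + 1) := by positivity
  linarith

lemma one_le_harm (n : ℕ) : 1 ≤ harm (n + 1) :=
  le_trans (by simp [harm]) (harm_mono (Nat.succ_le_succ (Nat.zero_le n)))

lemma tendsto_harm : Tendsto harm atTop atTop := Real.tendsto_sum_range_one_div_nat_succ_atTop

/-- The logarithmic cut-off profile at scale `n + 1`. -/
def profile (n k : ℕ) : ℝ := 1 - harm (min k (n + 1)) / harm (n + 1)

/-- A bound for the increments of the cut-off profile. -/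
def slope (n k : ℕ) : ℝ := if k ≤ n + 1 then 2 / (((k : ℝ) + 1) * harm (n + 1)) else 0

lemma slope_nonneg (n k : ℕ) : 0 ≤ slope n k := by
  have := one_le_harm n
  unfold slope; split_ifs <;> positivity

lemma abs_profile_succ_sub (n k : ℕ) :
    |profile n k - profile n (k + 1)| =
      if k ≤ n then 1 / (((k : ℝ) + 1) * harm (n + 1)) else 0 := by
  have := one_le_harm n
  have hp : 0 < harm (n + 1) := by linarith
  unfold profile
  split_ifs with h
  · rw [min_eq_left (by omega), min_eq_left (by omega), harm_succ k]
    have : (1 - harm k / harm (n + 1) - (1 - (harm k + 1 / ((k : ℝ) + 1)) / harm (n + 1))) =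
        1 / (((k : ℝ) + 1) * harm (n + 1)) := by
      field_simp; ring
    rw [this, abs_of_nonneg (by positivity)]
  · rw [min_eq_right (by omega), min_eq_right (by omega)]; simp

/-- The bound must depend on `k` alone. The inward increment is `1 / (k * harm (n + 1))`, hence the
factor `2` in `slope`. It can be nonzero at `k = n + 1`, hence the range there. -/
lemma abs_profile_sub_le (n k l : ℕ) (h1 : k ≤ l + 1) (h2 : l ≤ k + 1) :
    |profile n k - profile n l| ≤ slope n k := by
  have := one_le_harm n
  have hp : 0 < harm (n + 1) := by linarith
  obtain rfl | rfl | rfl : k = l ∨ l = k + 1 ∨ k = l + 1 := by omega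
  · simpa using slope_nonneg n k
  · rw [abs_profile_succ_sub, slope]
    split_ifs
    · gcongr; norm_num
    · omega
    · positivity
    · exact le_rfl
  · rw [abs_sub_comm, abs_profile_succ_sub, slope]
    split_ifs
    · rw [div_le_div_iff₀ (by positivity) (by positivity)]
      push_cast
      have : 0 ≤ (l : ℝ) * harm (n + 1) := by positivity
      nlinarith
    · omega
    · omega
    · exact le_rfl

/-- Distance to `o` in the maximum norm. -/
def radius (o z : Site) : ℕ := max (z.1 - o.1).natAbs (z.2 - o.2).natAbs

/-- The logarithmic cut-off function around `o`. -/
def cutoff (n : ℕ) (o z : Site) : ℝ := profile n (radius o z)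

lemma cutoff_self (n : ℕ) (o : Site) : cutoff n o o = 1 := by
  simp [cutoff, radius, profile, harm]

lemma finite_radius_le (o : Site) (n : ℕ) : {z : Site | radius o z ≤ n}.Finite := by
  refine Set.Finite.subset ((Set.finite_Icc (o.1 - n) (o.1 + n)).prod
    (Set.finite_Icc (o.2 - n) (o.2 + n))) fun z hz => ?_
  have hz' : radius o z ≤ n := hz
  simp only [radius] at hz'
  simp only [Set.mem_prod, Set.mem_Icc]
  omega

lemma hasFiniteSupport_cutoff (n : ℕ) (o : Site) : HasFiniteSupport (cutoff n o) := by
  refine Set.Finite.subset (finite_radius_le o n) fun z hz => ?_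
  by_contra hc
  have hc' : ¬ radius o z ≤ n := hc
  refine hz ?_
  have := one_le_harm n
  rw [cutoff, profile, min_eq_right (by omega), div_self (by linarith), sub_self]

lemma abs_cutoff_sub_le (n : ℕ) (o z : Site) (k l : ℤ) (hk : |k - z.1| ≤ 1) (hl : |l - z.2| ≤ 1) :
    |cutoff n o z - cutoff n o (k, l)| ≤ slope n (radius o z) := by
  rw [abs_le] at hk hl
  refine abs_profile_sub_le _ _ _ ?_ ?_ <;> simp only [radius] <;> omega

/-- The square of a component of the test flow, divided by the symmetric conductance. -/
lemma test_sq_div_le {a w w' x y y' s : ℝ} (ha : 0 < a) (hx : |x| ≤ s)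
    (hy : |y| ≤ s) (hy' : |y'| ≤ 3 * s) :
    (a * x + w * y + w' * y') ^ 2 / a ≤ 27 * s ^ 2 * (a + (w ^ 2 + w' ^ 2) / a) := by
  have hs : 0 ≤ s := (abs_nonneg x).trans hx
  have h1 : x ^ 2 ≤ s ^ 2 := sq_le_sq' (abs_le.1 hx).1 (abs_le.1 hx).2
  have h2 : y ^ 2 ≤ s ^ 2 := sq_le_sq' (abs_le.1 hy).1 (abs_le.1 hy).2
  have h3 : y' ^ 2 ≤ (3 * s) ^ 2 := sq_le_sq' (abs_le.1 hy').1 (abs_le.1 hy').2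
  have e : 27 * s ^ 2 * (a + (w ^ 2 + w' ^ 2) / a) =
      27 * s ^ 2 * (a ^ 2 + w ^ 2 + w' ^ 2) / a := by field_simp; ring
  rw [e]
  gcongr
  have k1 := mul_le_mul_of_nonneg_left h1 (sq_nonneg a)
  have k2 := mul_le_mul_of_nonneg_left h2 (sq_nonneg w)
  have k3 := mul_le_mul_of_nonneg_left h3 (sq_nonneg w')
  have k4 : 0 ≤ s ^ 2 * a ^ 2 := by positivity
  have k5 : 0 ≤ s ^ 2 * w ^ 2 := by positivity
  -- The constant is `27 = 3 * 3 ^ 2`: Cauchy–Schwarz for three terms, and the bound `3 * s` on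
  -- `y'`.
  nlinarith [sq_nonneg (a * x - w * y), sq_nonneg (a * x - w' * y'), sq_nonneg (w * y - w' * y')]

variable {a b W : Site → ℝ}

lemma testE_cutoff_le (ha : ∀ z, 0 < a z) (n : ℕ) (o z : Site) :
    testE a W (cutoff n o) z ^ 2 / a z ≤
      27 * slope n (radius o z) ^ 2 * (a z + (W z ^ 2 + W (z.1, z.2 - 1) ^ 2) / a z) := by
  set f := cutoff n o with hf
  have h1 : |f z - f (z.1 + 1, z.2)| ≤ slope n (radius o z) :=
    abs_cutoff_sub_le n o z _ _ (by simp) (by simp)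
  have h2 : |f z - f (z.1, z.2 - 1)| ≤ slope n (radius o z) :=
    abs_cutoff_sub_le n o z _ _ (by simp) (by simp)
  have h3 : |f (z.1 + 1, z.2) - f z| ≤ slope n (radius o z) := by rwa [abs_sub_comm]
  -- The expression inside the minus sign is twice the increment `f z - f (z.1, z.2 - 1)` minus the
  -- increment `f z - f (z.1 + 1, z.2)`.
  have h4 : |-(f z + f (z.1 + 1, z.2) - 2 * f (z.1, z.2 - 1))| ≤ 3 * slope n (radius o z) := by
    rw [abs_le] at *
    constructor <;> linarith [h1.1, h1.2, h2.1, h2.2]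
  refine le_trans (le_of_eq ?_) (test_sq_div_le (w := W z) (w' := W (z.1, z.2 - 1)) (ha z) h1 h3 h4)
  unfold testE; ring

lemma testN_cutoff_le (hb : ∀ z, 0 < b z) (n : ℕ) (o z : Site) :
    testN b W (cutoff n o) z ^ 2 / b z ≤
      27 * slope n (radius o z) ^ 2 * (b z + (W (z.1 - 1, z.2) ^ 2 + W z ^ 2) / b z) := by
  set f := cutoff n o with hf
  have h1 : |f z - f (z.1, z.2 + 1)| ≤ slope n (radius o z) :=
    abs_cutoff_sub_le n o z _ _ (by simp) (by simp)
  have h2 : |f z - f (z.1 - 1, z.2)| ≤ slope n (radius o z) :=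
    abs_cutoff_sub_le n o z _ _ (by simp) (by simp)
  have h4 : |f z + f (z.1, z.2 + 1) - 2 * f (z.1 - 1, z.2)| ≤ 3 * slope n (radius o z) := by
    rw [abs_le] at *
    constructor <;> linarith [h1.1, h1.2, h2.1, h2.2]
  refine le_trans (le_of_eq ?_) (test_sq_div_le (w := W z) (w' := W (z.1 - 1, z.2)) (hb z) h1 h1 h4)
    |>.trans_eq ?_
  · unfold testN; ring
  · ring

/-- The moment variable of the horizontal edge at a site. -/
def momentE (a W : Site → ℝ) (z : Site) : ℝ≥0∞ :=
  ENNReal.ofReal (a z + (W z ^ 2 + W (z.1, z.2 - 1) ^ 2) / a z)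
/-- The moment variable of the vertical edge at a site. -/
def momentN (b W : Site → ℝ) (z : Site) : ℝ≥0∞ :=
  ENNReal.ofReal (b z + (W (z.1 - 1, z.2) ^ 2 + W z ^ 2) / b z)

/-- A weighted sum of `M` over the boxes around `o`. -/
def boxSum (n : ℕ) (o : Site) (M : Site → ℝ≥0∞) : ℝ≥0∞ :=
  ∑ k ∈ Finset.range (n + 2), ENNReal.ofReal (27 * slope n k ^ 2) *
    ∑ z ∈ (Finset.box k : Finset Site), M (z + o)

/-- `Finset.box k` is the sphere of radius `k` in the maximum norm, and the slope vanishes beyond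
radius `n + 1`. -/
lemma tsum_radius_eq_boxSum (n : ℕ) (o : Site) (M : Site → ℝ≥0∞) :
    ∑' z, ENNReal.ofReal (27 * slope n (radius o z) ^ 2) * M z = boxSum n o M := by
  rw [← (Equiv.addRight o).tsum_eq]
  have hrad : ∀ z, radius o (z + o) = max z.1.natAbs z.2.natAbs := fun z => by simp [radius]
  simp only [Equiv.coe_addRight, hrad]
  rw [tsum_eq_sum (s := (Finset.range (n + 2)).biUnion fun k => (Finset.box k : Finset Site)),
    Finset.sum_biUnion]
  · unfold boxSum
    refine Finset.sum_congr rfl fun k _ => ?_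
    rw [Finset.mul_sum]
    refine Finset.sum_congr rfl fun z hz => ?_
    rw [Int.mem_box.1 hz]
  · intro k _ l _ hkl
    refine Finset.disjoint_left.2 fun z hz hz' => hkl ?_
    rw [← Int.mem_box.1 hz, ← Int.mem_box.1 hz']
  · intro z hz
    simp only [Finset.mem_biUnion, Finset.mem_range, Int.mem_box, not_exists, not_and] at hz
    have : ¬ max z.1.natAbs z.2.natAbs ≤ n + 1 := fun h => hz _ (by omega) rfl
    simp [slope, this]

lemma tsum_testFlow_cutoff_le (ha : ∀ z, 0 < a z) (hb : ∀ z, 0 < b z) (n : ℕ) (o : Site) :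
    ENNReal.ofReal (∑' z, (testE a W (cutoff n o) z ^ 2 / a z +
      testN b W (cutoff n o) z ^ 2 / b z)) ≤
      boxSum n o fun z => momentE a W z + momentN b W z := by
  have hnn : ∀ z, 0 ≤ testE a W (cutoff n o) z ^ 2 / a z + testN b W (cutoff n o) z ^ 2 / b z :=
    fun z => add_nonneg (div_nonneg (sq_nonneg _) (ha z).le) (div_nonneg (sq_nonneg _) (hb z).le)
  rw [ENNReal.ofReal_tsum_of_nonneg hnn (summable_of_hasFiniteSupport
    (hasFiniteSupport_testFlow a b W (hasFiniteSupport_cutoff n o))), ← tsum_radius_eq_boxSum]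
  refine ENNReal.tsum_le_tsum fun z => ?_
  have := ha z
  have := hb z
  rw [momentE, momentN, ← ENNReal.ofReal_add (by positivity) (by positivity),
    ← ENNReal.ofReal_mul (by positivity), mul_add]
  exact ENNReal.ofReal_le_ofReal (add_le_add (testE_cutoff_le ha n o z) (testN_cutoff_le hb n o z))

/-- The weights of the boxes are of the order of the inverse of a harmonic number. -/
lemma boxSum_const_le (n : ℕ) (o : Site) (K : ℝ≥0∞) :
    boxSum n o (fun _ => K) ≤ ENNReal.ofReal (2000 / harm (n + 1)) * K := by
  have h1 := one_le_harm n
  have hp : 0 < harm (n + 1) := by linarith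
  have hcard : ∀ k : ℕ, ((Finset.box k : Finset Site).card : ℝ) ≤ 8 * ((k : ℝ) + 1) := by
    intro k
    rcases eq_or_ne k 0 with rfl | hk
    · simp
    · rw [Int.card_box hk]; push_cast; linarith
  unfold boxSum
  simp only [Finset.sum_const, nsmul_eq_mul, ← mul_assoc]
  rw [← Finset.sum_mul]
  gcongr
  -- Here `864 = 27 * 2 ^ 2 * 8`, from the test-flow bound, the squared slope and the box size. One
  -- factor `k + 1` survives in the denominator, so the sum is harmonic.
  have hterm : ∀ k ∈ Finset.range (n + 2),
      ENNReal.ofReal (27 * slope n k ^ 2) * ((Finset.box k : Finset Site).card : ℝ≥0∞) ≤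
        ENNReal.ofReal (864 / harm (n + 1) ^ 2 * (1 / ((k : ℝ) + 1))) := by
    intro k hk
    rw [← ENNReal.ofReal_natCast, ← ENNReal.ofReal_mul (by positivity)]
    refine ENNReal.ofReal_le_ofReal ?_
    have hk' : k ≤ n + 1 := by have := Finset.mem_range.1 hk; omega
    calc 27 * slope n k ^ 2 * ((Finset.box k : Finset Site).card : ℝ)
        ≤ 27 * slope n k ^ 2 * (8 * ((k : ℝ) + 1)) := by gcongr; exact hcard k
      _ = _ := by rw [slope, if_pos hk']; field_simp; norm_num
  refine (Finset.sum_le_sum hterm).trans ?_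
  rw [← ENNReal.ofReal_sum_of_nonneg fun k _ => by positivity, ← Finset.mul_sum]
  refine ENNReal.ofReal_le_ofReal ?_
  change 864 / harm (n + 1) ^ 2 * harm (n + 2) ≤ _
  have h2 : harm (n + 2) ≤ 2 * harm (n + 1) := by
    rw [harm_succ (n + 1)]
    have : 1 / (((n + 1 : ℕ) : ℝ) + 1) ≤ 1 := by
      rw [div_le_one (by positivity)]; push_cast; linarith [n.cast_nonneg (α := ℝ)]
    linarith
  calc 864 / harm (n + 1) ^ 2 * harm (n + 2) ≤ 864 / harm (n + 1) ^ 2 * (2 * harm (n + 1)) := by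
        gcongr
    _ = 1728 / harm (n + 1) := by field_simp; norm_num
    _ ≤ _ := by gcongr; norm_num

/-- Variables with uniformly bounded expectation, weighted over boxes, are almost surely
arbitrarily small. -/
lemma ae_exists_boxSum_le {Ω : Type*} [MeasurableSpace Ω] (P : Measure Ω)
    {M : Site → Ω → ℝ≥0∞} (hM : ∀ z, Measurable (M z)) {K : ℝ≥0∞} (hK : K ≠ ⊤)
    (hMK : ∀ z, ∫⁻ ω, M z ω ∂P ≤ K) :
    ∀ᵐ ω ∂P, ∀ o : Site, ∀ ε : ℝ≥0∞, 0 < ε → ∃ n, boxSum n o (fun z => M z ω) ≤ ε := by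
  rw [ae_all_iff]
  intro o
  have hmeas : ∀ n, Measurable fun ω => boxSum n o (fun z => M z ω) := fun n => by
    unfold boxSum
    exact Finset.measurable_sum _ fun k _ =>
      (Finset.measurable_sum _ fun z _ => hM _).const_mul _
  have hint : ∀ n, ∫⁻ ω, boxSum n o (fun z => M z ω) ∂P ≤
      ENNReal.ofReal (2000 / harm (n + 1)) * K := by
    intro n
    refine le_trans ?_ (boxSum_const_le n o K)
    unfold boxSum
    rw [lintegral_finsetSum _ fun k _ =>
      (Finset.measurable_sum _ fun z _ => hM _).const_mul _]
    refine Finset.sum_le_sum fun k _ => ?_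
    rw [lintegral_const_mul _ (Finset.measurable_sum _ fun z _ => hM _),
      lintegral_finsetSum _ fun z _ => hM _]
    gcongr
    exact hMK _
  have hlim : Tendsto (fun n => ENNReal.ofReal (2000 / harm (n + 1)) * K) atTop (𝓝 0) := by
    have h1 : Tendsto (fun n => 2000 / harm (n + 1)) atTop (𝓝 0) :=
      (tendsto_harm.comp (tendsto_add_atTop_nat 1)).const_div_atTop _
    have h2 := ENNReal.Tendsto.mul_const (b := K) (ENNReal.tendsto_ofReal h1) (Or.inr hK)
    simpa using h2
  -- By Fatou, vanishing expectations force a vanishing lower limit. This suffices, since one good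
  -- scale is needed for each `ε`, and the null set does not depend on `ε`.
  have hzero : ∫⁻ ω, liminf (fun n => boxSum n o (fun z => M z ω)) atTop ∂P = 0 := by
    refine le_antisymm ((lintegral_liminf_le hmeas).trans ?_) zero_le
    calc liminf (fun n => ∫⁻ ω, boxSum n o (fun z => M z ω) ∂P) atTop
        ≤ liminf (fun n => ENNReal.ofReal (2000 / harm (n + 1)) * K) atTop :=
          liminf_le_liminf (Eventually.of_forall hint)
      _ = 0 := hlim.liminf_eq
  rw [lintegral_eq_zero_iff (Measurable.liminf hmeas)] at hzero
  filter_upwards [hzero] with ω hω ε hε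
  by_contra! hc
  have h : ε ≤ liminf (fun n => boxSum n o (fun z => M z ω)) atTop :=
    le_liminf_of_le (by isBoundedDefault) (Eventually.of_forall fun n => (hc n).le)
  simp only [Pi.zero_apply] at hω
  rw [hω] at h
  exact absurd hε (not_lt.2 h)

end Cutoff

end AsymConductance
end

/-! ### The almost sure statement -/

theorem lemma4p7 {Ω : Type*} [MeasurableSpace Ω] (P : Measure Ω) [IsProbabilityMeasure P]
    (cs : AsymConductance.Site → AsymConductance.Site → Ω → ℝ)
    (W : AsymConductance.Site → Ω → ℝ)
    (hcs_meas : ∀ x y, AsymConductance.IsArc x y → Measurable (cs x y))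
    (hW_meas : ∀ z, Measurable (W z))
    (hcs_pos : ∀ᵐ ω ∂P, ∀ x y, AsymConductance.IsArc x y → 0 < cs x y ω)
    (hcs_symm : ∀ᵐ ω ∂P, ∀ x y, AsymConductance.IsArc x y → cs x y ω = cs y x ω)
    (hdom : ∀ᵐ ω ∂P, ∀ x y, AsymConductance.IsArc x y →
      |AsymConductance.antisymPart (fun z => W z ω) x y| ≤ cs x y ω)
    (hmoment : ∃ C : ℝ≥0, ∀ x y zp zm : AsymConductance.Site, AsymConductance.IsArc x y →
      AsymConductance.cycleFlow zp x y = 1 → AsymConductance.cycleFlow zm x y = -1 →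
      ∫⁻ ω, ENNReal.ofReal (cs x y ω + ((W zp ω) ^ 2 + (W zm ω) ^ 2) / cs x y ω) ∂P ≤ C) :
    ∀ᵐ ω ∂P, ∀ m : AsymConductance.Site → ℝ, (∀ x, 0 < m x) →
      AsymConductance.IsRecurrent (fun x y =>
        AsymConductance.conductance (fun x y => cs x y ω) (fun z => W z ω) x y / m x) := by
  open AsymConductance in
  obtain ⟨C, hC⟩ := hmoment
  have hmE : ∀ z, Measurable fun ω =>
      momentE (fun z => cs z (z.1 + 1, z.2) ω) (fun z => W z ω) z := fun z => by
    have h1 := hcs_meas _ _ (isArc_right z)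
    have h2 := hW_meas z
    have h3 := hW_meas (z.1, z.2 - 1)
    unfold momentE
    fun_prop
  have hmN : ∀ z, Measurable fun ω =>
      momentN (fun z => cs z (z.1, z.2 + 1) ω) (fun z => W z ω) z := fun z => by
    have h1 := hcs_meas _ _ (isArc_up z)
    have h2 := hW_meas z
    have h3 := hW_meas (z.1 - 1, z.2)
    unfold momentN
    fun_prop
  -- One `C` is for the horizontal edge at `z`, with cycles at `z` and `z - e₂`, and one for the
  -- vertical edge, with cycles at `z - e₁` and `z`.
  have hsmall := ae_exists_boxSum_le P (K := (C : ℝ≥0∞) + C)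
    (fun z => (hmE z).add (hmN z)) (by simp) fun z => by
      simp only [Pi.add_apply]
      rw [lintegral_add_left (hmE z)]
      refine add_le_add (hC z _ z (z.1, z.2 - 1) (isArc_right z) ?_ ?_)
        (hC z _ (z.1 - 1, z.2) z (isArc_up z) ?_ ?_)
      · have : z.2 ≠ z.2 - 1 := by omega
        simpa [Prod.ext_iff, this] using cycleFlow_right z z.1 z.2
      · simpa [Prod.ext_iff] using cycleFlow_right (z.1, z.2 - 1) z.1 z.2
      · simpa [Prod.ext_iff] using cycleFlow_up (z.1 - 1, z.2) z.1 z.2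
      · have : z.1 ≠ z.1 - 1 := by omega
        simpa [Prod.ext_iff, this] using cycleFlow_up z z.1 z.2
  -- The exceptional null set is fixed before `m`, `o` and `ε` are chosen.
  filter_upwards [hcs_pos, hcs_symm, hdom, hsmall] with ω hp hs hd hω m hm
  refine isRecurrent_of_testFlow hp hs hd (fun o ε hε => ?_) hm
  obtain ⟨n, hn⟩ := hω o (ENNReal.ofReal ε) (ENNReal.ofReal_pos.2 hε)
  refine ⟨cutoff n o, hasFiniteSupport_cutoff n o, cutoff_self n o, ?_⟩
  rw [← ENNReal.ofReal_le_ofReal_iff hε.le]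
  exact (tsum_testFlow_cutoff_le (fun z => hp _ _ (isArc_right z))
    (fun z => hp _ _ (isArc_up z)) n o).trans hn
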